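/- A linear group is a group isomorphic to a subgroup of $\mathrm{GL}_n(F)$ for some natural number $n$ and some field $F$. A pseudofinite group is an infinite group satisfying every first-order sentence (in the language of groups) that holds in all finite groups. For a prime $p$, a $p$-group is a group in which every element has order a power of $p$, and a Sylow $p$-subgroup of a group is a $p$-subgroup that is maximal with respect to inclusion. Let $p$ be a prime and let $G$ be a linear pseudofinite group. (a) $G$ does not have both a finite Sylow $p$-subgroup and an infinite Sylow $p$-subgroup. (b) Let $(G_i)_{i\in I}$ be a family of finite groups and $\mathcal{U}$ a non-principal ultrafilter on $I$ such that $G$ is elementarily equivalent to the ultraproduct $\prod_{i\in I} G_i/\mathcal{U}$. Then $G$ has a finite Sylow $p$-subgroup if and only if there is a natural number $B$ such that the set of those $i\in I$ for which all Sylow $p$-subgroups of $G_i$ have order at most $B$ belongs to $\mathcal{U}$. -/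

import Mathlib

universe u v w x

/-- The function symbols of the first-order language of groups. -/
inductive GroupFunc : ℕ → Type
  | mul : GroupFunc 2
  | inv : GroupFunc 1
  | one : GroupFunc 0

/-- The first-order language of groups: multiplication, inversion and the neutral element, and no
relation symbols (besides equality). -/
def groupLanguage : FirstOrder.Language.{0, 0} where
  Functions := GroupFunc
  Relations := fun _ => Empty

/-- Every group is a structure for the language of groups in the obvious way. -/
instance groupLanguageStructure (G : Type*) [Group G] : groupLanguage.Structure G where
  funMap := fun f x =>
    match f, x with
    | GroupFunc.mul, x => x 0 * x 1
    | GroupFunc.inv, x => (x 0)⁻¹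
    | GroupFunc.one, _ => 1
  RelMap := fun r => Empty.elim r

/-- The common theory of finite groups: all sentences of the language of groups that hold in every
finite group. Each finite group is isomorphic to one whose carrier lives in `Type`, so it is enough
to quantify over those. -/
def finiteGroupTheory : groupLanguage.Theory :=
  {φ | ∀ (H : Type) [Group H] [Finite H], FirstOrder.Language.Sentence.Realize H φ}

/-- A pseudofinite group is an infinite model of the common theory of finite groups. -/
def IsPseudofiniteGroup (G : Type*) [Group G] : Prop :=
  Infinite G ∧ FirstOrder.Language.Theory.Model G finiteGroupTheory

/-- A linear group is a group isomorphic to a subgroup of `GL n F`, for some `n` and some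
field `F` (in an arbitrary universe). -/
def IsLinearGroup (G : Type u) [Group G] : Prop :=
  ∃ (F : Type v) (_ : Field F) (n : ℕ) (H : Subgroup (Matrix.GeneralLinearGroup (Fin n) F)),
    Nonempty (G ≃* H)

/-- `G ≡ ∏ i, H i / U`: the group `G` is elementarily equivalent, in the language of groups, to
the ultraproduct of the groups `H i` over `U`. -/
def IsElemEquivUltraproduct (G : Type*) [Group G] {I : Type*} (H : I → Type*)
    [∀ i, Group (H i)] (U : Ultrafilter I) : Prop :=
  groupLanguage.ElementarilyEquivalent G ((U : Filter I).Product H)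

/-!
Two first-order properties of a group and a prime power `p ^ k` carry the proof.

The first says that some subgroup `P` of order `p ^ k` contains every `g` in its normalizer with
`g ^ p ∈ P` (`Set.IsNormalizerRootClosed`). Every finite Sylow `p`-subgroup of an arbitrary group
has this property, since otherwise adjoining `g` would give a larger `p`-subgroup
(`Sylow.isNormalizerRootClosed`). In a finite group the property forces `P` to be a Sylow subgroup,
so that there is no subgroup of order `p ^ (k + 1)` (`Set.IsNormalizerRootClosed.card_ne`).

The second says that there is no subgroup of order `p ^ m`. In a linear group it makes all
`p`-subgroups finite (`IsLinearGroup.finite_of_isPGroup`). Indeed their exponent divides `p ^ m`,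
so by Burnside's theorem their finitely generated subgroups are finite
(`Representation.finiteIndex_ker_of_exponent`), and a finite `p`-subgroup of order at least `p ^ m`
would contain one of order exactly `p ^ m`.

Hence a finite Sylow `p`-subgroup of a linear pseudofinite group `G` forces all `p`-subgroups of `G`
to be finite, because the implication from the first property to the second holds in all finite
groups. For an ultraproduct of finite groups, Łoś's theorem transfers the first property from `G`
to almost all factors, where it bounds the Sylow subgroups. Conversely, if almost all factors have
Sylow `p`-subgroups of order at most `B`, they have no subgroup of order `p ^ B > B`, so neither
has `G`.
-/

/-! ### Traces of linear maps of finite order -/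

/-- The trace is the sum of the roots of the characteristic polynomial, which form a multiset of
bounded size with elements among the `N`-th roots of unity. -/
theorem LinearMap.finite_trace_of_pow_eq_one {K V : Type*} [Field K] [IsAlgClosed K]
    [AddCommGroup V] [Module K V] [FiniteDimensional K V] {N : ℕ} (hN : 0 < N) :
    (LinearMap.trace K V '' {f : Module.End K V | f ^ N = 1}).Finite := by
  classical
  have hfin : (Set.Iic (Module.finrank K V • (Polynomial.nthRootsFinset N (1 : K)).val)).Finite :=
    Set.finite_Iic _
  refine (hfin.image Multiset.sum).subset ?_
  rintro _ ⟨f, hf, rfl⟩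
  have hs : f.charpoly.Splits := IsAlgClosed.splits _
  refine ⟨f.charpoly.roots, ?_, (Module.End.trace_eq_sum_roots_charpoly_of_splits hs).symm⟩
  rw [Set.mem_Iic, Multiset.le_iff_count]
  intro a
  by_cases ha : a ∈ f.charpoly.roots
  · have hroot : Module.End.HasEigenvalue f a := by
      rw [Module.End.hasEigenvalue_iff_isRoot_charpoly]
      exact (Polynomial.mem_roots'.1 ha).2
    obtain ⟨v, hv⟩ := hroot.exists_hasEigenvector
    have haN : a ^ N = 1 := by
      have h := hv.pow_apply N
      rw [show f ^ N = 1 from hf, Module.End.one_apply] at h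
      have h' : (a ^ N - 1) • v = 0 := by rw [sub_smul, one_smul, ← h, sub_self]
      exact sub_eq_zero.1 ((smul_eq_zero.1 h').resolve_right hv.2)
    have hmem : a ∈ (Polynomial.nthRootsFinset N (1 : K)).val :=
      (Polynomial.mem_nthRootsFinset hN 1).2 haN
    calc f.charpoly.roots.count a ≤ Multiset.card f.charpoly.roots := Multiset.count_le_card _ _
      _ ≤ f.charpoly.natDegree := Polynomial.card_roots' _
      _ = Module.finrank K V * 1 := by rw [LinearMap.charpoly_natDegree, mul_one]
      _ ≤ _ := by
        rw [Multiset.count_nsmul]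
        exact Nat.mul_le_mul_left _ (Multiset.one_le_count_iff_mem.2 hmem)
  · rw [Multiset.count_eq_zero_of_notMem ha]
    exact Nat.zero_le _

/-- The trace form of the full endomorphism algebra is nondegenerate. -/
theorem LinearMap.eq_zero_of_forall_trace_mul_eq_zero {K V : Type*} [Field K]
    [AddCommGroup V] [Module K V] [FiniteDimensional K V] {f : Module.End K V}
    (h : ∀ g : Module.End K V, LinearMap.trace K V (f * g) = 0) : f = 0 := by
  ext x
  rw [LinearMap.zero_apply, ← Module.forall_dual_apply_eq_zero_iff K]
  intro φ
  -- Multiplying by the rank-one map `v ↦ φ v • x` isolates `φ (f x)`.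
  have hx := h (φ.smulRight x)
  have : f * φ.smulRight x = φ.smulRight (f x) := by ext; simp
  rwa [this, LinearMap.trace_smulRight] at hx

/-! ### Linear groups of finite exponent -/

namespace Representation

/-- **Burnside's theorem** on matrix algebras: over an algebraically closed field, the operators
of an irreducible representation of a group span the whole endomorphism algebra. -/
theorem IsIrreducible.span_range_eq_top {K Q V : Type*} [Field K] [IsAlgClosed K] [Group Q]
    [AddCommGroup V] [Module K V] [FiniteDimensional K V] (ρ : Representation K Q V)
    [ρ.IsIrreducible] : Submodule.span K (Set.range ρ) = ⊤ := by
  classical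
  rw [eq_top_iff]
  intro f _
  let A := MonoidAlgebra K Q
  let M := ρ.asModule
  have hM : IsSimpleModule A M := inferInstance
  have : FiniteDimensional K M := inferInstanceAs (FiniteDimensional K V)
  have hscalar := (IsSimpleModule.algebraMap_end_bijective_of_isAlgClosed (A := A) (V := M) K).2
  -- By Schur's lemma the commutant of `Q` is `K`, so `f` is linear over it.
  let F : Module.End (Module.End A M) M :=
    { toFun := fun m => ρ.asModuleEquiv.symm (f (ρ.asModuleEquiv m))
      map_add' := by intro a b; simp
      map_smul' := by
        intro c m
        obtain ⟨k, rfl⟩ := hscalar c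
        simp }
  let b := Module.finBasis K V
  obtain ⟨r, hr⟩ := jacobson_density F (Finset.univ.image fun i => ρ.asModuleEquiv.symm (b i))
  have hf : f = ρ.asAlgebraHom r := by
    refine b.ext fun i => ?_
    have := hr (ρ.asModuleEquiv.symm (b i)) (Finset.mem_image_of_mem _ (Finset.mem_univ i))
    have h2 := congrArg ρ.asModuleEquiv this
    exact h2
  rw [hf, asAlgebraHom_def, MonoidAlgebra.lift_apply]
  exact Submodule.sum_mem _ fun q _ => Submodule.smul_mem _ _ (Submodule.subset_span ⟨q, rfl⟩)

/-- An operator `ρ q` is determined by the traces of its products with finitely many operators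
`ρ a` spanning the endomorphism algebra, and these traces take finitely many values. -/
theorem IsIrreducible.finite_range_of_exponent {K Q V : Type*} [Field K] [IsAlgClosed K] [Group Q]
    [AddCommGroup V] [Module K V] [FiniteDimensional K V] (ρ : Representation K Q V)
    [ρ.IsIrreducible] {N : ℕ} (hN : 0 < N) (hQ : ∀ q : Q, q ^ N = 1) : (Set.range ρ).Finite := by
  classical
  obtain ⟨s, hs, hspan⟩ := (Submodule.fg_span_iff_fg_span_finset_subset (Set.range ρ)).1
    (IsNoetherian.noetherian (R := K) (Submodule.span K (Set.range ρ)))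
  rw [IsIrreducible.span_range_eq_top ρ] at hspan
  let T : Set K := LinearMap.trace K V '' {f : Module.End K V | f ^ N = 1}
  have hT : T.Finite := LinearMap.finite_trace_of_pow_eq_one hN
  let τ : Module.End K V → (s → K) := fun f a => LinearMap.trace K V (f * a)
  have hpi : (Set.univ.pi fun _ : s => T).Finite := Set.Finite.pi fun _ => hT
  refine Set.Finite.of_finite_image (f := τ) (hpi.subset ?_) ?_
  · rintro _ ⟨_, ⟨q, rfl⟩, rfl⟩ a _
    obtain ⟨q', hq'⟩ := hs a.2
    refine ⟨ρ q * a, ?_, rfl⟩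
    rw [Set.mem_ofPred_eq, ← hq', ← map_mul, ← map_pow, hQ, map_one]
  · rintro f _ g _ hfg
    rw [← sub_eq_zero]
    refine LinearMap.eq_zero_of_forall_trace_mul_eq_zero fun h => ?_
    have hmem : h ∈ Submodule.span K (s : Set (Module.End K V)) := hspan ▸ Submodule.mem_top
    induction hmem using Submodule.span_induction with
    | mem a ha =>
      have := congrFun hfg ⟨a, ha⟩
      simpa [sub_mul, sub_eq_zero, τ] using this
    | zero => simp
    | add a b _ _ iha ihb => rw [mul_add, map_add, iha, ihb, add_zero]
    | smul c a _ iha => rw [mul_smul_comm, map_smul, iha, smul_zero]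

/-- **Burnside's theorem** on linear groups of finite exponent, in the finitely generated case:
such a group acts through a finite quotient. The proof is by induction on the dimension. If `W` is a
proper nonzero invariant subspace, then the elements acting trivially on `W` and on `V ⧸ W` form a
subgroup of finite index, hence finitely generated, and its image is abelian of finite exponent,
hence finite. -/
theorem finiteIndex_ker_of_exponent {K Q V : Type*} [Field K] [IsAlgClosed K] [Group Q]
    [Group.FG Q] [AddCommGroup V] [Module K V] [FiniteDimensional K V] (ρ : Representation K Q V)
    {N : ℕ} (hN : 0 < N) (hQ : ∀ q : Q, q ^ N = 1) : ρ.toHomUnits.ker.FiniteIndex := by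
  induction hn : Module.finrank K V using Nat.strong_induction_on generalizing V with
  | _ n ih =>
  by_cases hirr : ρ.IsIrreducible
  · have hfin := IsIrreducible.finite_range_of_exponent ρ hN hQ
    have : Finite ρ.toHomUnits.range := by
      refine Set.Finite.to_subtype (Set.Finite.of_finite_image (f := Units.val)
        (hfin.subset ?_) Units.val_injective.injOn)
      rintro _ ⟨_, ⟨q, rfl⟩, rfl⟩
      exact ⟨q, rfl⟩
    exact Subgroup.finiteIndex_ker _
  by_cases hW : ∃ W : Submodule K V, W ≠ ⊥ ∧ W ≠ ⊤ ∧ ∀ q, ∀ v ∈ W, ρ q v ∈ W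
  · obtain ⟨W, hbot, htop, hinv⟩ := hW
    let σ : Representation K Q W := Subrepresentation.toRepresentation ⟨W, fun q v hv => hinv q v hv⟩
    let τ : Representation K Q (V ⧸ W) :=
      { toFun := fun q => W.mapQ W (ρ q) (hinv q)
        map_one' := by ext; simp
        map_mul' := by intro a b; ext; simp }
    have hσ := ih _ (hn ▸ Submodule.finrank_lt htop) σ rfl
    have hτ := ih _ (by
      have := W.finrank_quotient_add_finrank
      have := Submodule.one_le_finrank_iff.2 hbot
      omega) τ rfl
    let L := σ.toHomUnits.ker ⊓ τ.toHomUnits.ker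
    have hL : L.FiniteIndex := inferInstance
    let f := ρ.toHomUnits.comp L.subtype
    have hfix : ∀ a ∈ L, ∀ v ∈ W, ρ a v = v := by
      intro a ha v hv
      have h1 : σ a = 1 := congrArg Units.val (MonoidHom.mem_ker.1 ha.1)
      exact congrArg Subtype.val (LinearMap.congr_fun h1 ⟨v, hv⟩)
    have hquot : ∀ a ∈ L, ∀ v, ρ a v - v ∈ W := by
      intro a ha v
      have h1 : τ a = 1 := congrArg Units.val (MonoidHom.mem_ker.1 ha.2)
      exact (Submodule.Quotient.eq W).1 (LinearMap.congr_fun h1 (W.mkQ v))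
    have hprod : ∀ a ∈ L, ∀ b ∈ L, ∀ v, ρ a (ρ b v) = ρ a v + ρ b v - v := by
      intro a ha b hb v
      have := hfix a ha _ (hquot b hb v)
      rw [map_sub, sub_eq_iff_eq_add] at this
      rw [this]; abel
    -- On `L` one has `(ρ a - 1) * (ρ b - 1) = 0`, so the image of `L` is commutative.
    have hcomm : ∀ a ∈ L, ∀ b ∈ L, ρ (a * b) = ρ (b * a) := by
      intro a ha b hb
      ext v
      rw [map_mul, map_mul, Module.End.mul_apply, Module.End.mul_apply, hprod a ha b hb,
        hprod b hb a ha, add_comm]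
    let _ : CommGroup f.range :=
      { (inferInstance : Group f.range) with
        mul_comm := by
          rintro ⟨_, a, rfl⟩ ⟨_, b, rfl⟩
          exact Subtype.ext (Units.ext (by
            simpa [f] using hcomm a a.2 b b.2)) }
    have hfg : Group.FG f.range := inferInstance
    have : Finite f.range := by
      refine CommGroup.finite_of_fg_isMulTorsion _ fun x => isOfFinOrder_iff_pow_eq_one.2 ⟨N, hN, ?_⟩
      obtain ⟨_, a, rfl⟩ := x
      refine Subtype.ext ?_
      change f a ^ N = 1
      rw [← map_pow, show a ^ N = 1 from Subtype.ext (hQ a), map_one]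
    have hf : f.ker.FiniteIndex := Subgroup.finiteIndex_ker f
    have hmap : (f.ker.map L.subtype).FiniteIndex := by
      constructor
      rw [Subgroup.index_map_subtype]
      exact mul_ne_zero hf.index_ne_zero hL.index_ne_zero
    refine Subgroup.finiteIndex_of_le (H := f.ker.map L.subtype) ?_
    rintro _ ⟨a, ha, rfl⟩
    exact ha
  · -- Only the zero representation has no proper nonzero invariant subspace without being
    -- irreducible.
    have hsub : Subsingleton V := by
      by_contra hV
      rw [not_subsingleton_iff_nontrivial] at hV
      refine hirr ?_
      refine { exists_pair_ne := ⟨⊥, ⊤, fun h => ?_⟩, eq_bot_or_eq_top := fun W => ?_ }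
      · exact bot_ne_top (congrArg Subrepresentation.toSubmodule h : (⊥ : Submodule K V) = ⊤)
      · by_contra! h
        exact hW ⟨W.toSubmodule, fun h' => h.1 (Subrepresentation.toSubmodule_injective h'),
          fun h' => h.2 (Subrepresentation.toSubmodule_injective h'),
          fun q v hv => W.apply_mem_toSubmodule q hv⟩
    have : ρ.toHomUnits.ker = ⊤ := by
      rw [eq_top_iff]
      intro q _
      exact Units.ext (Subsingleton.elim _ _)
    rw [this]
    infer_instance

end Representation

/-! ### Finiteness of `p`-subgroups of linear groups -/

theorem IsPGroup.card_lt_of_forall_card_ne {p m : ℕ} (hp : p.Prime) {G : Type*} [Group G]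
    (hno : ∀ K : Subgroup G, Nat.card K ≠ p ^ m) {R : Subgroup G} (hR : IsPGroup p R) :
    Nat.card R < p ^ m := by
  by_contra! h
  obtain ⟨K, hK⟩ := Sylow.exists_subgroup_card_pow_prime_of_le_card hp hR h
  exact hno (K.map R.subtype) (by rw [Subgroup.card_map_of_injective R.subtype_injective, hK])

theorem IsPGroup.pow_eq_one_of_forall_card_ne {p m : ℕ} (hp : p.Prime) {G : Type*} [Group G]
    (hno : ∀ K : Subgroup G, Nat.card K ≠ p ^ m) {Q : Subgroup G} (hQ : IsPGroup p Q) (q : Q) :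
    q ^ p ^ m = 1 := by
  have : Fact p.Prime := ⟨hp⟩
  obtain ⟨k, hk⟩ := IsPGroup.iff_orderOf.1 hQ q
  have hZ : IsPGroup p ((Subgroup.zpowers q).map Q.subtype) :=
    (hQ.to_subgroup (Subgroup.zpowers q)).map Q.subtype
  have hlt := IsPGroup.card_lt_of_forall_card_ne hp hno hZ
  rw [Subgroup.card_map_of_injective Q.subtype_injective, Nat.card_zpowers, hk] at hlt
  rw [← orderOf_dvd_iff_pow_eq_one, hk]
  exact pow_dvd_pow p ((Nat.pow_lt_pow_iff_right hp.one_lt).1 hlt).le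

/-- Extending scalars to the algebraic closure turns a linear group into a faithful
representation. -/
theorem IsLinearGroup.finite_of_exponent {G : Type u} [Group G] (hG : IsLinearGroup.{u, v} G)
    (R : Subgroup G) [Group.FG R] {N : ℕ} (hN : 0 < N) (hR : ∀ r : R, r ^ N = 1) : Finite R := by
  obtain ⟨F, _, n, S, ⟨e⟩⟩ := hG
  let K := AlgebraicClosure F
  let ι : R →* Matrix (Fin n) (Fin n) K :=
    (Units.coeHom _).comp ((Matrix.GeneralLinearGroup.map (algebraMap F K)).comp
      (S.subtype.comp (e.toMonoidHom.comp R.subtype)))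
  have hι : Function.Injective ι := by
    intro a b hab
    have h1 : (e (a : G) : Matrix.GeneralLinearGroup (Fin n) F) = e (b : G) := by
      refine Units.ext (Matrix.ext fun i j => ?_)
      exact (algebraMap F K).injective (congrFun (congrFun hab i) j)
    exact Subtype.ext (e.injective (Subtype.ext h1))
  let ρ : Representation K R (Fin n → K) :=
    (Matrix.toLinAlgEquiv' : _ ≃ₐ[K] Module.End K (Fin n → K)).toAlgHom.toMonoidHom.comp ι
  have hρ : ρ.toHomUnits.ker = ⊥ := by
    rw [MonoidHom.ker_eq_bot_iff]
    intro a b hab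
    exact hι (Matrix.toLinAlgEquiv'.injective (congrArg Units.val hab))
  have := ρ.finiteIndex_ker_of_exponent hN hR
  rw [hρ] at this
  exact Nat.finite_of_card_ne_zero (Subgroup.index_bot (G := R) ▸ this.index_ne_zero)

/-- If a linear group has no subgroup of order `p ^ m`, then its `p`-subgroups have exponent
dividing `p ^ m`, so they are locally finite, and their finite subgroups have order below
`p ^ m`. -/
theorem IsLinearGroup.finite_of_isPGroup {G : Type u} [Group G] (hG : IsLinearGroup.{u, v} G)
    {p m : ℕ} (hp : p.Prime) (hno : ∀ K : Subgroup G, Nat.card K ≠ p ^ m) {Q : Subgroup G}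
    (hQ : IsPGroup p Q) : Finite Q := by
  by_contra hinf
  rw [not_finite_iff_infinite] at hinf
  obtain ⟨s, hs⟩ := Infinite.exists_subset_card_eq Q (p ^ m)
  let R := Subgroup.closure (Subtype.val '' (s : Set Q))
  have hRQ : R ≤ Q := (Subgroup.closure_le _).2 (by rintro _ ⟨q, _, rfl⟩; exact q.2)
  have hR : IsPGroup p R := hQ.to_le hRQ
  have : Finite (Subtype.val '' (s : Set Q)) := (s.finite_toSet.image _).to_subtype
  have hfg : Group.FG R := Group.closure_finite_fg _
  have hfin : Finite R := hG.finite_of_exponent R (pow_pos hp.pos m)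
    (hR.pow_eq_one_of_forall_card_ne hp hno)
  have hlt := IsPGroup.card_lt_of_forall_card_ne hp hno hR
  have hle : (Subtype.val '' (s : Set Q)).ncard ≤ (R : Set G).ncard :=
    Set.ncard_le_ncard Subgroup.subset_closure (Set.toFinite _)
  rw [Set.ncard_image_of_injective _ Subtype.val_injective, Set.ncard_coe_finset, hs] at hle
  exact hlt.not_ge hle

/-! ### Finite Sylow subgroups -/

/-- Every element `g` with `g * P * g⁻¹ ⊆ P` and `g ^ p ∈ P` lies in `P`. For a finite subgroup `P`
this says that `N(P) / P` has no element of order `p`, a condition that is first order in an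
enumeration of `P`. It is stated for sets so that it applies to the range of such an
enumeration. -/
def Set.IsNormalizerRootClosed {G : Type*} [Group G] (p : ℕ) (P : Set G) : Prop :=
  ∀ g : G, (∀ x ∈ P, g * x * g⁻¹ ∈ P) → g ^ p ∈ P → g ∈ P

theorem Sylow.isNormalizerRootClosed {p : ℕ} {G : Type*} [Group G] (P : Sylow p G) [Finite P] :
    Set.IsNormalizerRootClosed p (P : Set G) := by
  intro g hg hgp
  have hgN : g ∈ Subgroup.normalizer (P : Set G) :=
    Subgroup.mem_normalizer_fintype hg
  have hZ : IsPGroup p (Subgroup.zpowers g) := by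
    obtain ⟨k, hk⟩ := P.isPGroup' ⟨g ^ p, hgp⟩
    have hk' : g ^ p ^ (k + 1) = 1 := by
      rw [pow_succ', pow_mul]; exact congrArg Subtype.val hk
    rintro ⟨_, z, rfl⟩
    refine ⟨k + 1, Subtype.ext ?_⟩
    change (g ^ z) ^ p ^ (k + 1) = 1
    rw [← zpow_natCast, zpow_comm, zpow_natCast, hk', one_zpow]
  have hsup := P.isPGroup'.to_sup_of_normal_left' hZ (by simpa using hgN)
  have hmem : g ∈ (P : Subgroup G) := by
    rw [← P.is_maximal' hsup le_sup_left]
    exact (le_sup_right : Subgroup.zpowers g ≤ _) (Subgroup.mem_zpowers g)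
  exact hmem

/-- In a finite group, a `p`-subgroup satisfying `Set.IsNormalizerRootClosed` is a Sylow
subgroup: a strictly larger `p`-subgroup would contain one in which it has index `p` and is
therefore normal. -/
theorem Set.IsNormalizerRootClosed.card_ne {p k : ℕ} (hp : p.Prime) {G : Type*} [Group G] [Finite G]
    {P : Subgroup G} (hP : Set.IsNormalizerRootClosed p (P : Set G)) (hcard : Nat.card P = p ^ k)
    (K : Subgroup G) : Nat.card K ≠ p ^ (k + 1) := by
  intro hK
  have : Fact p.Prime := ⟨hp⟩
  obtain ⟨L, hL, hPL⟩ := Sylow.exists_subgroup_card_pow_succ (hK ▸ K.card_subgroup_dvd_card) hcard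
  have hindex : (P.subgroupOf L).index = p := by
    have h := (P.subgroupOf L).card_mul_index
    rw [Nat.card_congr (Subgroup.subgroupOfEquivOfLe hPL).toEquiv, hcard, hL, pow_succ] at h
    exact Nat.eq_of_mul_eq_mul_left (pow_pos hp.pos k) h
  have hnormal : (P.subgroupOf L).Normal := by
    refine Subgroup.normal_of_index_eq_minFac_card ?_
    rw [hindex, hL, hp.pow_minFac (Nat.succ_ne_zero k)]
  have hle : L ≤ P := by
    intro g hg
    refine hP g (fun x hx => ?_) ?_
    · exact hnormal.conj_mem ⟨x, hPL hx⟩ hx ⟨g, hg⟩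
    · have := (P.subgroupOf L).pow_index_mem ⟨g, hg⟩
      rw [hindex] at this
      exact this
  have := Subgroup.card_le_of_le hle
  rw [hL, hcard] at this
  exact this.not_gt (Nat.pow_lt_pow_right hp.one_lt (Nat.lt_succ_self k))

/-! ### Subgroups of a given finite order -/

/-- A nonempty finite subset of a group closed under multiplication is a subgroup. -/
theorem Subgroup.exists_coe_eq_of_mul_mem {G : Type*} [Group G] {S : Set G} (hS : S.Finite)
    (hne : S.Nonempty) (hmul : ∀ a ∈ S, ∀ b ∈ S, a * b ∈ S) : ∃ P : Subgroup G, (P : Set G) = S := by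
  have : Finite S := hS
  have hdiv : ∀ a ∈ S, ∀ b ∈ S, ∃ c ∈ S, a * c = b := by
    intro a ha b hb
    have hinj : Function.Injective fun c : S => (⟨a * c, hmul a ha c c.2⟩ : S) := by
      intro c d hcd
      exact Subtype.ext (mul_left_cancel (congrArg Subtype.val hcd))
    obtain ⟨c, hc⟩ := Finite.surjective_of_injective hinj ⟨b, hb⟩
    exact ⟨c, c.2, congrArg Subtype.val hc⟩
  have hone : (1 : G) ∈ S := by
    obtain ⟨a, ha⟩ := hne
    obtain ⟨c, hc, h⟩ := hdiv a ha a ha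
    rwa [← mul_eq_left.1 h]
  refine ⟨{ carrier := S, mul_mem' := fun {a b} ha hb => hmul a ha b hb, one_mem' := hone,
            inv_mem' := fun {a} ha => ?_ }, rfl⟩
  obtain ⟨c, hc, h⟩ := hdiv a ha 1 hone
  rwa [inv_eq_of_mul_eq_one_right h]

/-- Quantifying over the subgroups of order `m` amounts to quantifying over injective `m`-tuples
whose range is closed under multiplication. -/
theorem Subgroup.exists_card_eq_iff {G : Type*} [Group G] {m : ℕ} (hm : 0 < m) (Φ : Set G → Prop) :
    (∃ x : Fin m → G, Function.Injective x ∧ (∀ i j, ∃ l, x i * x j = x l) ∧ Φ (Set.range x)) ↔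
      ∃ P : Subgroup G, Nat.card P = m ∧ Φ P := by
  constructor
  · rintro ⟨x, hinj, hmul, hΦ⟩
    obtain ⟨P, hP⟩ := Subgroup.exists_coe_eq_of_mul_mem (Set.finite_range x) ⟨_, ⟨0, hm⟩, rfl⟩ (by
      rintro _ ⟨i, rfl⟩ _ ⟨j, rfl⟩
      obtain ⟨l, hl⟩ := hmul i j
      exact ⟨l, hl.symm⟩)
    refine ⟨P, ?_, hP ▸ hΦ⟩
    change Nat.card (P : Set G) = m
    rw [hP, Nat.card_range_of_injective hinj, Nat.card_fin]
  · rintro ⟨P, hcard, hΦ⟩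
    have : Finite P := Nat.finite_of_card_ne_zero (hcard ▸ hm.ne')
    let e : P ≃ Fin m := Finite.equivFinOfCardEq hcard
    have hrange : Set.range (fun i => (e.symm i : G)) = P := by
      rw [← Function.comp_def, e.symm.surjective.range_comp]
      exact Subtype.range_coe
    refine ⟨fun i => e.symm i, Subtype.val_injective.comp e.symm.injective, fun i j => ?_, ?_⟩
    · exact ⟨e (e.symm i * e.symm j), by simp⟩
    · rwa [hrange]

/-! ### First-order sentences about finite subgroups -/

namespace groupLanguage

open FirstOrder Language

/-- The product of two terms. -/
def mulTerm {α : Type*} (s t : groupLanguage.Term α) : groupLanguage.Term α :=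
  Functions.apply₂ (L := groupLanguage) GroupFunc.mul s t

/-- The inverse of a term. -/
def invTerm {α : Type*} (t : groupLanguage.Term α) : groupLanguage.Term α :=
  Functions.apply₁ (L := groupLanguage) GroupFunc.inv t

/-- The power of a term with a fixed natural exponent. -/
def powTerm {α : Type*} (t : groupLanguage.Term α) : ℕ → groupLanguage.Term α
  | 0 => Constants.term (L := groupLanguage) GroupFunc.one
  | n + 1 => mulTerm (powTerm t n) t

variable {G : Type*} [Group G] {α : Type*} (v : α → G)

@[simp] theorem realize_mulTerm (s t : groupLanguage.Term α) :
    (mulTerm s t).realize v = s.realize v * t.realize v :=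
  rfl

@[simp] theorem realize_invTerm (t : groupLanguage.Term α) :
    (invTerm t).realize v = (t.realize v)⁻¹ :=
  rfl

@[simp] theorem realize_powTerm (t : groupLanguage.Term α) (n : ℕ) :
    (powTerm t n).realize v = t.realize v ^ n := by
  induction n with
  | zero => exact (pow_zero _).symm
  | succ n ih => rw [powTerm, realize_mulTerm, ih, pow_succ]

/-- The formula saying that the variables `x 0, …, x (m - 1)` are pairwise distinct and form a set
closed under multiplication. -/
noncomputable def enumFormula (m : ℕ) : groupLanguage.Formula (Empty ⊕ Fin m) :=
  (Formula.iInf fun ij : {ij : Fin m × Fin m // ij.1 ≠ ij.2} =>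
    ((Term.var (Sum.inr ij.1.1)).equal (Term.var (Sum.inr ij.1.2))).not) ⊓
  Formula.iInf fun ij : Fin m × Fin m => Formula.iSup fun l : Fin m =>
    (mulTerm (Term.var (Sum.inr ij.1)) (Term.var (Sum.inr ij.2))).equal (Term.var (Sum.inr l))

theorem realize_enumFormula {m : ℕ} (v : Empty → G) (x : Fin m → G) :
    (enumFormula m).Realize (Sum.elim v x) ↔
      Function.Injective x ∧ ∀ i j, ∃ l, x i * x j = x l := by
  simp only [enumFormula, Formula.realize_inf, Formula.realize_iInf, Formula.realize_iSup,
    Formula.realize_not, Formula.realize_equal, Term.realize_var, realize_mulTerm, Sum.elim_inr,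
    Subtype.forall, Prod.forall]
  refine and_congr_left' ⟨fun h i j hij => ?_, fun h i j hij => h.ne hij⟩
  by_contra hne
  exact h i j hne hij

/-- The sentence saying that there is a subgroup of order `m` (for `0 < m`). -/
noncomputable def existsSubgroupCard (m : ℕ) : groupLanguage.Sentence :=
  (enumFormula m).iExs (Fin m)

theorem realize_existsSubgroupCard {m : ℕ} (hm : 0 < m) :
    Sentence.Realize G (existsSubgroupCard m) ↔ ∃ P : Subgroup G, Nat.card P = m := by
  rw [Sentence.Realize, existsSubgroupCard, Formula.realize_iExs]
  simpa only [realize_enumFormula, and_true] using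
    Subgroup.exists_card_eq_iff (G := G) hm fun _ => True

/-- The formula saying that if the variable `g` maps the set of the variables `x i` into itself by
conjugation and has its `p`-th power in that set, then `g` is in the set. -/
noncomputable def normalizerRootClosedFormula (p m : ℕ) : groupLanguage.Formula ((Empty ⊕ Fin m) ⊕ Unit) :=
  let x : Fin m → groupLanguage.Term ((Empty ⊕ Fin m) ⊕ Unit) := fun i => Term.var (.inl (.inr i))
  let g : groupLanguage.Term ((Empty ⊕ Fin m) ⊕ Unit) := Term.var (.inr ())
  (Formula.iInf fun i : Fin m => Formula.iSup fun j : Fin m =>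
      (x j).equal (mulTerm (mulTerm g (x i)) (invTerm g))).imp
    ((Formula.iSup fun j : Fin m => (x j).equal (powTerm g p)).imp
      (Formula.iSup fun j : Fin m => (x j).equal g))

theorem realize_normalizerRootClosedFormula {p m : ℕ} (v : Empty → G) (x : Fin m → G) :
    ((normalizerRootClosedFormula p m).iAlls Unit).Realize (Sum.elim v x) ↔
      Set.IsNormalizerRootClosed p (Set.range x) := by
  simp only [Formula.realize_iAlls, normalizerRootClosedFormula, Formula.realize_imp,
    Formula.realize_iInf, Formula.realize_iSup, Formula.realize_equal, Term.realize_var,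
    realize_mulTerm, realize_invTerm, realize_powTerm, Sum.elim_inl, Sum.elim_inr,
    Set.IsNormalizerRootClosed, Set.forall_mem_range]
  simp only [Set.mem_range]
  exact ⟨fun h g => h fun _ => g, fun h g => h (g ())⟩

/-- The sentence saying that there is a subgroup of order `m` satisfying
`Set.IsNormalizerRootClosed` (for `0 < m`). -/
noncomputable def existsNormalizerRootClosed (p m : ℕ) : groupLanguage.Sentence :=
  (enumFormula m ⊓ (normalizerRootClosedFormula p m).iAlls Unit).iExs (Fin m)

theorem realize_existsNormalizerRootClosed {p m : ℕ} (hm : 0 < m) :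
    Sentence.Realize G (existsNormalizerRootClosed p m) ↔
      ∃ P : Subgroup G, Nat.card P = m ∧ Set.IsNormalizerRootClosed p (P : Set G) := by
  rw [Sentence.Realize, existsNormalizerRootClosed, Formula.realize_iExs,
    ← Subgroup.exists_card_eq_iff (G := G) hm]
  simp only [Formula.realize_inf, realize_enumFormula, realize_normalizerRootClosedFormula, and_assoc]

end groupLanguage

/-! ### Sylow subgroups of linear pseudofinite groups -/

theorem mainTheorem3 (p : ℕ) (hp : p.Prime) (G : Type u) [Group G]
    (hlin : IsLinearGroup.{u, v} G) (hpf : IsPseudofiniteGroup G) :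
    (¬ ((∃ P : Sylow p G, Finite P) ∧ (∃ Q : Sylow p G, Infinite Q))) ∧
    (∀ (I : Type w) (H : I → Type x) [∀ i, Group (H i)] [∀ i, Finite (H i)] (U : Ultrafilter I),
      (∀ i, U ≠ pure i) → IsElemEquivUltraproduct G H U →
      ((∃ P : Sylow p G, Finite P) ↔
        ∃ B : ℕ, ∀ᶠ i in (U : Filter I), ∀ P : Sylow p (H i), Nat.card P ≤ B)) := by
  have : Fact p.Prime := ⟨hp⟩
  have hsylow : ∀ P : Sylow p G, Finite P → ∃ k, FirstOrder.Language.Sentence.Realize G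
      (groupLanguage.existsNormalizerRootClosed p (p ^ k)) := by
    intro P hP
    obtain ⟨k, hk⟩ := P.isPGroup'.exists_card_eq
    exact ⟨k, (groupLanguage.realize_existsNormalizerRootClosed (pow_pos hp.pos k)).2
      ⟨P, hk, P.isNormalizerRootClosed⟩⟩
  refine ⟨?_, ?_⟩
  · rintro ⟨⟨P, hP⟩, Q, hQ⟩
    obtain ⟨k, hk⟩ := hsylow P hP
    have hmem : (groupLanguage.existsNormalizerRootClosed p (p ^ k)).imp
        (groupLanguage.existsSubgroupCard (p ^ (k + 1))).not ∈ finiteGroupTheory := by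
      intro K _ _ hK hK'
      obtain ⟨P, hP, hcl⟩ := (groupLanguage.realize_existsNormalizerRootClosed (pow_pos hp.pos k)).1 hK
      obtain ⟨L, hL⟩ := (groupLanguage.realize_existsSubgroupCard (pow_pos hp.pos (k + 1))).1 hK'
      exact hcl.card_ne hp hP L hL
    have hno := hpf.2.realize_of_mem _ hmem hk
    refine hQ.not_finite (hlin.finite_of_isPGroup hp (m := k + 1) (fun K hK => hno ?_) Q.isPGroup')
    exact (groupLanguage.realize_existsSubgroupCard (pow_pos hp.pos (k + 1))).2 ⟨K, hK⟩
  · intro I H _ _ U _ hequiv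
    have hlos : ∀ φ : groupLanguage.Sentence, FirstOrder.Language.Sentence.Realize G φ ↔
      ∀ᶠ i in (U : Filter I), FirstOrder.Language.Sentence.Realize (H i) φ := fun φ =>
        (hequiv.realize_sentence φ).trans (FirstOrder.Language.Ultraproduct.sentence_realize φ)
    constructor
    · rintro ⟨P, hP⟩
      obtain ⟨k, hk⟩ := hsylow P hP
      refine ⟨p ^ (k + 1), ((hlos _).1 hk).mono fun i hi S => ?_⟩
      obtain ⟨R, hR, hcl⟩ := (groupLanguage.realize_existsNormalizerRootClosed (pow_pos hp.pos k)).1 hi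
      exact (IsPGroup.card_lt_of_forall_card_ne hp (hcl.card_ne hp hR) S.isPGroup').le
    · rintro ⟨B, hB⟩
      have hno : ∀ K : Subgroup G, Nat.card K ≠ p ^ B := by
        intro K hK
        have hev := (hlos _).1
          ((groupLanguage.realize_existsSubgroupCard (pow_pos hp.pos B)).2 ⟨K, hK⟩)
        obtain ⟨i, hi, hBi⟩ := (hev.and hB).exists
        obtain ⟨L, hL⟩ := (groupLanguage.realize_existsSubgroupCard (pow_pos hp.pos B)).1 hi
        obtain ⟨S, hS⟩ := (IsPGroup.of_card hL).exists_le_sylow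
        have hle := (Subgroup.card_le_of_le hS).trans (hBi S)
        rw [hL] at hle
        exact hle.not_gt (Nat.lt_pow_self hp.one_lt)
      obtain ⟨P⟩ := (inferInstance : Nonempty (Sylow p G))
      exact ⟨P, hlin.finite_of_isPGroup hp hno P.isPGroup'⟩
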